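/- Let $K$ be a field, not necessarily algebraically closed or complete, with an absolute value $|\cdot|$ (archimedean or non-archimedean, possibly trivial). Let $d\ge 2$, and let $F_1,F_2\in K[x,y]$ be homogeneous polynomials of degree $d$ with no common linear factor over $\overline{K}$. Let $\operatorname{Res}(F)$ be the homogeneous resultant of $F_1,F_2$ (the determinant of the $2d\times 2d$ Sylvester matrix of their coefficients). Consider the map $F=(F_1,F_2):K^2\to K^2$ with iterates $F^{(n)}$, put $\|(z_0,z_1)\|=\max\{|z_0|,|z_1|\}$ and $z\wedge w=z_0w_1-z_1w_0$, and let $$K_F=\Big\{z\in K^2 : \sup_{n\ge 0}\|F^{(n)}(z)\|<\infty\Big\}$$ be the filled Julia set of $F$. For a bounded set $E\subset K^2$ and $n\ge 2$ let $$d^0_n(E)=\sup_{z_1,\dots,z_n\in E}\Big(\prod_{i\ne j}|z_i\wedge z_j|\Big)^{\frac1{n(n-1)}},$$ the product being over ordered pairs of distinct indices $i,j\in\{1,\dots,n\}$, and let $d^0_\infty(E)=\lim_{n\to\infty}d^0_n(E)$ be the homogeneous transfinite diameter of $E$. Then $K_F$ is bounded, the limit defining $d^0_\infty(K_F)$ exists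 in $\mathbb{R}$, $\operatorname{Res}(F)\neq 0$, and $$d^0_\infty(K_F)\ \le\ |\operatorname{Res}(F)|^{-\frac{1}{d(d-1)}}.$$ -/

import Mathlib

open Filter Topology

noncomputable section

/-- The form `G(x, y)` dehomogenized to the one-variable polynomial `G(T, 1)`. -/
def dehomogenize {K : Type*} [Field K] (G : MvPolynomial (Fin 2) K) : Polynomial K :=
  MvPolynomial.aeval ![Polynomial.X, 1] G

/-- The homogeneous resultant `Res(F₁, F₂)` of two binary forms of degree `d`: the determinant of
the `2d × 2d` Sylvester matrix of the coefficients of `F₁` and `F₂`, both regarded as having formal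
degree `d` (so that vanishing leading coefficients are allowed). -/
def homResultant {K : Type*} [Field K] (d : ℕ) (F : Fin 2 → MvPolynomial (Fin 2) K) : K :=
  Polynomial.resultant (dehomogenize (F 0)) (dehomogenize (F 1)) d d

/-- The two polynomials have no common linear factor (nonzero linear form) over the algebraic
closure of `K`. -/
def NoCommonLinearFactor {K : Type*} [Field K] (F : Fin 2 → MvPolynomial (Fin 2) K) : Prop :=
  ∀ L : MvPolynomial (Fin 2) (AlgebraicClosure K), L.IsHomogeneous 1 → L ≠ 0 →
    ¬ ∀ i, L ∣ MvPolynomial.map (algebraMap K (AlgebraicClosure K)) (F i)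

/-- The self-map `z ↦ (F₁(z), F₂(z))` of `K²`. -/
def planeMap {K : Type*} [Field K] (F : Fin 2 → MvPolynomial (Fin 2) K) (z : Fin 2 → K) :
    Fin 2 → K :=
  fun i => MvPolynomial.eval z (F i)

/-- `‖(z₀, z₁)‖ = max {|z₀|, |z₁|}`. -/
def maxNorm {K : Type*} [Field K] (v : AbsoluteValue K ℝ) (z : Fin 2 → K) : ℝ :=
  max (v (z 0)) (v (z 1))

/-- `E ⊆ K²` is bounded for the absolute value `v`. -/
def IsBoundedFor {K : Type*} [Field K] (v : AbsoluteValue K ℝ) (E : Set (Fin 2 → K)) : Prop :=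
  ∃ B : ℝ, ∀ z ∈ E, maxNorm v z ≤ B

/-- The filled Julia set of `F`: the points of `K²` with bounded forward orbit. -/
def filledJulia {K : Type*} [Field K] (v : AbsoluteValue K ℝ)
    (F : Fin 2 → MvPolynomial (Fin 2) K) : Set (Fin 2 → K) :=
  {z | ∃ B : ℝ, ∀ n : ℕ, maxNorm v ((planeMap F)^[n] z) ≤ B}

/-- `z ∧ w = z₀ w₁ - z₁ w₀`. -/
def wedge {K : Type*} [Field K] (z w : Fin 2 → K) : K :=
  z 0 * w 1 - z 1 * w 0

/-- `d⁰ₙ(E) = sup_{z₁, …, zₙ ∈ E} (∏_{i ≠ j} |zᵢ ∧ zⱼ|)^{1/(n(n-1))}`, the product being over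
ordered pairs of distinct indices; meaningful for bounded `E` and `n ≥ 2`. -/
def homDiameter {K : Type*} [Field K] (v : AbsoluteValue K ℝ) (E : Set (Fin 2 → K)) (n : ℕ) : ℝ :=
  ⨆ z : Fin n → E,
    (∏ i : Fin n, ∏ j ∈ Finset.univ.erase i, v (wedge (z i : Fin 2 → K) (z j))) ^
      (1 / ((n : ℝ) * ((n : ℝ) - 1)))

/-- The homogeneous transfinite diameter `d⁰_∞(E) = lim d⁰ₙ(E)`. -/
def homTransfiniteDiameter {K : Type*} [Field K] (v : AbsoluteValue K ℝ)
    (E : Set (Fin 2 → K)) : ℝ :=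
  limUnder atTop (homDiameter v E)

end

/-! The proof compares Vandermonde determinants of points of `K_F` with those of their images, using
only that `F` maps `K_F` into itself. Write `R` for the resultant and take `N = d(m+1)` points. The
products `x^i y^(d-1-i) F₁^k F₂^(m-k)` with `i < d` and `k ≤ m` are `N` forms of degree `N - 1`, and
their coefficient matrix in the monomial basis has determinant `R^(m(m+1)/2)`
(`det_powerFamilyMatrix`). Hence this power of `R` times the Vandermonde determinant of the points
is the determinant of the values of these products.

Each value is a bounded factor depending on `i` times a degree `m` monomial in the image point.
Multilinear expansion in the rows reduces the determinant to products of `d` Vandermonde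
determinants of `m + 1` image points (`abs_det_mul_le`), at the cost of a factor exponential in `N`.
With `D_n` for the `n`-th diameter, squaring and taking `(m+1)`-th roots gives `|R|^m D_N^(d(N-1)) ≤
A D_(m+1)^(dm)` with `A` independent of `m`. Fekete monotonicity replaces `D_N` by its limit `D`,
and `m → ∞` yields `|R| D^(d²) ≤ D^d`, which is the claim when `D > 0`.

Boundedness of `K_F` comes from `R ≠ 0`: Cramer's rule for the Sylvester matrix puts `R x^(2d-1)`
and `R y^(2d-1)` in the ideal of `F₁, F₂`, so large vectors escape. -/

/-! ### Resultants and the determinant of the power family. -/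

section Algebra

open Polynomial

/-- The resultant of a power, for arbitrary formal degrees. -/
theorem resultant_pow_left_of_natDegree_le {K : Type*} [Field K] {f g : K[X]} {d : ℕ} (hd : 0 < d)
    (hf : f.natDegree ≤ d) (hg : g.natDegree ≤ d) (m : ℕ) :
    resultant (f ^ m) g (d * m) d = resultant f g d d ^ m := by
  rcases eq_or_ne f 0 with rfl | hf0
  · rcases m.eq_zero_or_pos with rfl | hm
    · simp
    · rw [zero_pow hm.ne']; simp [hm.ne', hd.ne']
  -- `c` is the drop of the degree of `f` below `d`. Each unit of it multiplies the resultant by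
  -- `(-1)^d * g.coeff d`, and the drop for `f ^ m` is `c * m`.
  obtain ⟨c, hc⟩ := le_iff_exists_add.mp hf
  have h1 : resultant f g d d = (-1) ^ (d * c) * g.coeff d ^ c * resultant f g f.natDegree d := by
    have := resultant_add_left_deg f g f.natDegree d c le_rfl
    rwa [← hc] at this
  have h2 : d * m = (f ^ m).natDegree + c * m := by
    rw [natDegree_pow]; conv_lhs => rw [hc]
    ring
  rw [h2, resultant_add_left_deg _ _ _ _ _ le_rfl,
    resultant_pow_left f g m d (pow_ne_zero _ (leadingCoeff_ne_zero.mpr hf0)) hg, h1]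
  ring

theorem coeff_mul_eq_sum_fin {R : Type*} [CommSemiring R] (g p : R[X]) {N : ℕ}
    (hp : p.degree < N) (r : ℕ) :
    (g * p).coeff r = ∑ j : Fin N, if (j : ℕ) ≤ r then g.coeff (r - j) * p.coeff j else 0 := by
  rcases N.eq_zero_or_pos with rfl | hN
  · have : p = 0 := by simpa [degree_eq_bot] using hp
    simp [this]
  have hp' : p.natDegree < N := by
    rcases eq_or_ne p 0 with rfl | h0
    · simpa using hN
    · exact (natDegree_lt_iff_degree_lt h0).2 hp
  conv_lhs => rw [p.as_sum_range' N hp']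
  rw [Finset.mul_sum, finsetSum_coeff, Finset.sum_range]
  refine Finset.sum_congr rfl fun j _ => ?_
  rw [← C_mul_X_pow_eq_monomial, ← mul_assoc, coeff_mul_X_pow']
  simp

/-- The coefficient matrix of the family `X ^ i * f ^ k * g ^ (m - k)`, `i < d`, `k ≤ m`,
the pair `(k, i)` being encoded as `i + d * k`. -/
noncomputable def powerFamilyMatrix {K : Type*} [Field K] (f g : K[X]) (d m : ℕ) :
    Matrix (Fin (d * m + d)) (Fin (d * m + d)) K :=
  .of fun r c => (X ^ (c % d : ℕ) * f ^ (c / d : ℕ) * g ^ (m - c / d : ℕ)).coeff r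

theorem div_le_of_lt_mul_add {d m c : ℕ} (hc : c < d * m + d) : c / d ≤ m := by
  have : c < (m + 1) * d := by nlinarith
  exact Nat.lt_succ_iff.1 (Nat.div_lt_of_lt_mul (by linarith))

theorem degree_powerFamily_lt {K : Type*} [Field K] {f g : K[X]} {d : ℕ} (hd : 0 < d)
    (hf : f.natDegree ≤ d) (hg : g.natDegree ≤ d) {m c : ℕ} (hc : c < d * m + d) :
    (X ^ (c % d) * f ^ (c / d) * g ^ (m - c / d)).degree < ((d * m + d : ℕ) : WithBot ℕ) := by
  refine degree_le_natDegree.trans_lt (Nat.cast_lt.2 ?_)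
  have hk := div_le_of_lt_mul_add hc
  have h1 : (f ^ (c / d)).natDegree ≤ c / d * d := natDegree_pow_le_of_le _ hf
  have h2 : (g ^ (m - c / d)).natDegree ≤ (m - c / d) * d := natDegree_pow_le_of_le _ hg
  have h3 : (c / d) * d + (m - c / d) * d = d * m := by
    rw [← add_mul, Nat.add_sub_cancel' hk, mul_comm]
  have h4 : c % d < d := Nat.mod_lt _ hd
  have h5 := natDegree_mul_le (p := X ^ (c % d) * f ^ (c / d)) (q := g ^ (m - c / d))
  have h6 := natDegree_mul_le (p := (X : K[X]) ^ (c % d)) (q := f ^ (c / d))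
  rw [natDegree_X_pow] at h6
  omega

/-- In the family of level `m + 1`, the members with `k ≤ m` are `g` times those of level `m`, and
the members with `k = m + 1` are the shifts `X ^ i * f ^ (m + 1)`. These are images under the
Sylvester map `(p, q) ↦ g * p + f ^ (m + 1) * q`, which gives the factorization. -/
theorem powerFamilyMatrix_succ {K : Type*} [Field K] {f g : K[X]} {d : ℕ} (hd : 0 < d)
    (hf : f.natDegree ≤ d) (hg : g.natDegree ≤ d) (m : ℕ) :
    powerFamilyMatrix f g d (m + 1) = sylvester (f ^ (m + 1)) g (d * (m + 1)) d *
      Matrix.reindex finSumFinEquiv finSumFinEquiv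
        (Matrix.fromBlocks (powerFamilyMatrix f g d m) 0 0 (1 : Matrix (Fin d) (Fin d) K)) := by
  have hfm : (f ^ (m + 1)).natDegree ≤ d * (m + 1) := by
    rw [mul_comm]; exact natDegree_pow_le_of_le _ hf
  ext r c
  rw [Matrix.mul_apply, ← finSumFinEquiv.sum_comp, Fintype.sum_sum_type]
  obtain ⟨c, rfl⟩ := finSumFinEquiv.surjective c
  rcases c with c | c
  · have hc : (c : ℕ) < d * m + d := c.2
    have hk := div_le_of_lt_mul_add hc
    have : (X ^ (c % d : ℕ) * f ^ (c / d : ℕ) * g ^ (m + 1 - c / d : ℕ)) =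
        g * (X ^ (c % d : ℕ) * f ^ (c / d : ℕ) * g ^ (m - c / d : ℕ)) := by
      rw [Nat.succ_sub hk, pow_succ]; ring
    simp only [powerFamilyMatrix, Matrix.of_apply, finSumFinEquiv_apply_left, Fin.val_castAdd, this]
    rw [coeff_mul_eq_sum_fin _ _ (degree_powerFamily_lt hd hf hg hc)]
    simp only [sylvester, Matrix.of_apply, finSumFinEquiv_apply_right,
      Matrix.reindex_apply, Matrix.submatrix_apply, Fin.addCases_left, Fin.addCases_right]
    rw [← finSumFinEquiv_apply_left]
    simp only [← finSumFinEquiv_apply_left, ← finSumFinEquiv_apply_right, Equiv.symm_apply_apply,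
      Matrix.fromBlocks_apply₁₁, Matrix.fromBlocks_apply₂₁, Matrix.zero_apply, mul_zero,
      Finset.sum_const_zero, add_zero, Matrix.of_apply]
    refine Finset.sum_congr rfl fun j _ => ?_
    simp only [Set.mem_Icc]
    by_cases h : (j : ℕ) ≤ r
    · by_cases h' : (r : ℕ) ≤ j + d
      · simp [h, h']
      · have : g.coeff (r - j) = 0 := coeff_eq_zero_of_natDegree_lt (by omega)
        simp [this]
    · simp [h]
  · have h1 : (d * (m + 1) + (c : ℕ)) % d = c := by
      rw [Nat.mul_add_mod, Nat.mod_eq_of_lt c.2]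
    have h2 : (d * (m + 1) + (c : ℕ)) / d = m + 1 := by
      rw [Nat.mul_add_div hd, Nat.div_eq_of_lt c.2, add_zero]
    simp only [powerFamilyMatrix, Matrix.of_apply, finSumFinEquiv_apply_right, Fin.val_natAdd, h1,
      h2]
    simp only [sylvester, Matrix.of_apply, finSumFinEquiv_apply_left, Matrix.reindex_apply, Matrix.submatrix_apply, Fin.addCases_left, Fin.addCases_right]
    simp only [← finSumFinEquiv_apply_left, ← finSumFinEquiv_apply_right, Equiv.symm_apply_apply,
      Matrix.fromBlocks_apply₁₂, Matrix.fromBlocks_apply₂₂, Matrix.zero_apply, mul_zero,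
      Finset.sum_const_zero, zero_add, Matrix.one_apply, mul_ite, mul_one, Finset.sum_ite_eq',
      Finset.mem_univ, if_true, Nat.sub_self, pow_zero]
    rw [mul_comm, coeff_mul_X_pow']
    simp only [Set.mem_Icc]
    by_cases h : (c : ℕ) ≤ r
    · by_cases h' : (r : ℕ) ≤ c + d * (m + 1)
      · simp [h, h']
      · have : (f ^ (m + 1)).coeff (r - c) = 0 := coeff_eq_zero_of_natDegree_lt (by omega)
        simp [this]
    · simp [h]

/-- Passing from level `m` to `m + 1` contributes the resultant of `f ^ (m + 1)` and `g`, that is,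
the `(m + 1)`-th power of the resultant of `f` and `g`; level `0` is the identity. -/
theorem det_powerFamilyMatrix {K : Type*} [Field K] {f g : K[X]} {d : ℕ} (hd : 0 < d)
    (hf : f.natDegree ≤ d) (hg : g.natDegree ≤ d) (m : ℕ) :
    (powerFamilyMatrix f g d m).det = resultant f g d d ^ (∑ k ∈ Finset.range (m + 1), k) := by
  induction m with
  | zero =>
    have : powerFamilyMatrix f g d 0 = 1 := by
      ext r c
      have hc : (c : ℕ) < d := by simpa using c.2
      simp [powerFamilyMatrix, Nat.mod_eq_of_lt hc, Nat.div_eq_of_lt hc, coeff_X_pow,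
        Matrix.one_apply, Fin.ext_iff]
    rw [this, Matrix.det_one]; simp
  | succ m ih =>
    rw [powerFamilyMatrix_succ hd hf hg, Matrix.det_mul, Matrix.det_reindex_self,
      Matrix.det_fromBlocks_zero₁₂, Matrix.det_one, mul_one, ih]
    have := resultant_pow_left_of_natDegree_le hd hf hg (m + 1)
    rw [resultant] at this
    rw [this, ← pow_add, Finset.sum_range_succ _ (m + 1), add_comm]

theorem eval_homogenize_eq_sum {K : Type*} [Field K] (p : K[X]) (n : ℕ) (z : Fin 2 → K) :
    MvPolynomial.eval z (p.homogenize n) =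
      ∑ r : Fin (n + 1), p.coeff r * (z 0 ^ (r : ℕ) * z 1 ^ (r.rev : ℕ)) := by
  rw [homogenize, map_sum, Finset.Nat.sum_antidiagonal_eq_sum_range_succ_mk, Finset.sum_range]
  refine Finset.sum_congr rfl fun r _ => ?_
  rw [Finsupp.update_eq_add_single (by simp), MvPolynomial.eval_monomial, Finsupp.prod_add_index'
    (by simp) (by intros; rw [pow_add])]
  simp [Fin.val_rev]

/-- Products `z ^ i * F (z) ^ k` of monomials and values of a pair of binary forms are obtained
from the monomials by the matrix of the power family. -/
theorem projVandermonde_mul_powerFamilyMatrix {K : Type*} [Field K] {f g : K[X]} {d : ℕ}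
    (hd : 0 < d) (hf : f.natDegree ≤ d) (hg : g.natDegree ≤ d) (m : ℕ)
    (z : Fin (d * m + d) → Fin 2 → K) (j c : Fin (d * m + d)) :
    (Matrix.projVandermonde (fun j => z j 0) (fun j => z j 1) * powerFamilyMatrix f g d m) j c =
      (z j 0 ^ (c % d : ℕ) * z j 1 ^ (d - 1 - c % d : ℕ)) *
        (MvPolynomial.eval (z j) (f.homogenize d) ^ (c / d : ℕ) *
          MvPolynomial.eval (z j) (g.homogenize d) ^ (m - c / d : ℕ)) := by
  have hk := div_le_of_lt_mul_add c.2
  have h4 : (c : ℕ) % d < d := Nat.mod_lt _ hd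
  have hpow : ∀ (q : K[X]) (k : ℕ), q.natDegree ≤ d →
      (q ^ k).homogenize (d * k) = q.homogenize d ^ k := by
    intro q k hq
    have := homogenize_finsetProd (s := Finset.range k) (p := fun _ => q) (n := fun _ => d)
      (fun _ _ => hq)
    simpa [mul_comm] using this
  have h1 : (f ^ (c / d : ℕ)).natDegree ≤ d * (c / d) := by
    exact (natDegree_pow_le_of_le _ hf).trans_eq (mul_comm _ _)
  have h2 : (g ^ (m - c / d : ℕ)).natDegree ≤ d * (m - c / d) := by
    exact (natDegree_pow_le_of_le _ hg).trans_eq (mul_comm _ _)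
  -- The formal degrees are `d - 1` for `X ^ i`, which produces the cofactor `y ^ (d - 1 - i)`, and
  -- `d` for each factor `f` or `g`. Their sum is one less than the number of points.
  have h3 : (d - 1 + d * (c / d)) + d * (m - c / d) + 1 = d * m + d := by
    have : d * (c / d) + d * (m - c / d) = d * m := by
      rw [← mul_add, Nat.add_sub_cancel' hk]
    omega
  have key := eval_homogenize_eq_sum (X ^ (c % d : ℕ) * f ^ (c / d : ℕ) * g ^ (m - c / d : ℕ))
    ((d - 1 + d * (c / d)) + d * (m - c / d)) (z j)
  rw [homogenize_mul _ _ (natDegree_mul_le.trans (add_le_add _ h1)) h2,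
    homogenize_mul _ _ _ h1, homogenize_X_pow (by omega), hpow _ _ hf, hpow _ _ hg] at key
  · simp only [map_mul, map_pow, MvPolynomial.eval_X] at key
    rw [← mul_assoc, key, Matrix.mul_apply]
    rw [← (finCongr h3).sum_comp]
    refine Finset.sum_congr rfl fun r _ => ?_
    simp only [Matrix.projVandermonde_apply, powerFamilyMatrix, Matrix.of_apply, finCongr_apply,
      Fin.val_cast, Fin.val_rev, h3]
    ring
  all_goals rw [natDegree_X_pow]; omega

end Algebra

/-! ### Expansion of the determinant into Vandermonde determinants of image points. -/

section DeterminantBound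

variable {K : Type*} [Field K]

theorem AbsoluteValue.map_sign_det_eq (v : AbsoluteValue K ℝ) {n : Type*} [Fintype n]
    [DecidableEq n] (σ : Equiv.Perm n) (M : Matrix n n K) :
    v (M.submatrix σ id).det = v M.det := by
  rw [Matrix.det_permute, map_mul]
  rcases Int.units_eq_one_or (Equiv.Perm.sign σ) with h | h <;> simp [h]

/-- A matrix whose row `j` is supported on the block `c j` has zero determinant, or is block
diagonal up to a permutation of the rows. -/
theorem abs_det_coloured_le (v : AbsoluteValue K ℝ) {ι κ : Type*} [Fintype ι] [Fintype κ]
    [DecidableEq ι] [DecidableEq κ] (b : κ × ι → κ → K) {Q : ℝ} (hQ0 : 0 ≤ Q)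
    (hQ : ∀ y : κ → κ × ι, v (Matrix.of fun l k => b (y l) k).det ≤ Q) (c : κ × ι → ι) :
    v (Matrix.of fun j x : κ × ι => if c j = x.2 then b j x.1 else 0).det ≤
      Q ^ Fintype.card ι := by
  -- Such a `σ` sorts the rows by colour. Without one, every term of the Leibniz expansion contains
  -- an entry whose row colour differs from its column block, hence a zero.
  by_cases h : ∃ σ : Equiv.Perm (κ × ι), ∀ x, c (σ x) = x.2
  · obtain ⟨σ, hσ⟩ := h
    rw [← v.map_sign_det_eq σ]
    have : (Matrix.of fun j x : κ × ι => if c j = x.2 then b j x.1 else 0).submatrix σ id =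
        Matrix.blockDiagonal fun i => Matrix.of fun l k => b (σ (l, i)) k := by
      ext ⟨l, i⟩ ⟨k, i'⟩
      simp [Matrix.blockDiagonal_apply, hσ]
    rw [this, Matrix.det_blockDiagonal, map_prod]
    refine (Finset.prod_le_prod (fun _ _ => v.nonneg _)
      (fun i _ => hQ fun l => σ (l, i))).trans_eq ?_
    simp
  · push Not at h
    rw [Matrix.det_apply, Finset.sum_eq_zero, map_zero]
    · positivity
    · intro σ _
      obtain ⟨x, hx⟩ := h σ
      rw [Finset.prod_eq_zero (Finset.mem_univ x), smul_zero]
      simp [hx]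

/-- A bound for the determinant of a matrix with entries `a j i * b j k` at `(j, (k, i))` in terms
of the minors of `b`. -/
theorem abs_det_mul_le (v : AbsoluteValue K ℝ) {ι κ : Type*} [Fintype ι] [Fintype κ]
    [DecidableEq ι] [DecidableEq κ] (a : κ × ι → ι → K) (b : κ × ι → κ → K) {C Q : ℝ}
    (hC0 : 0 ≤ C) (hC : ∀ j i, v (a j i) ≤ C) (hQ0 : 0 ≤ Q)
    (hQ : ∀ y : κ → κ × ι, v (Matrix.of fun l k => b (y l) k).det ≤ Q) :
    v (Matrix.of fun j x : κ × ι => a j x.2 * b j x.1).det ≤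
      (Fintype.card ι * C) ^ Fintype.card (κ × ι) * Q ^ Fintype.card ι := by
  -- Each row is split by blocks, so that multilinearity gives a sum over all colourings of the
  -- rows; their number accounts for the power of `Fintype.card ι` in the bound.
  have hrow : (fun j x : κ × ι => a j x.2 * b j x.1) =
      fun j => ∑ i, a j i • (fun x : κ × ι => if i = x.2 then b j x.1 else 0) := by
    ext j x
    simp
  have hdet : (Matrix.of fun j x : κ × ι => a j x.2 * b j x.1).det = ∑ c : κ × ι → ι,
      (∏ j, a j (c j)) *
        (Matrix.of fun j x : κ × ι => if c j = x.2 then b j x.1 else 0).det := by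
    have := (Matrix.detRowAlternating (R := K) (n := κ × ι)).toMultilinearMap.map_sum
      (fun j i => a j i • (fun x : κ × ι => if i = x.2 then b j x.1 else 0))
    rw [← hrow] at this
    refine this.trans (Finset.sum_congr rfl fun c _ => ?_)
    exact MultilinearMap.map_smul_univ _ (fun j => a j (c j)) _
  rw [hdet]
  refine (v.sum_le _ _).trans ?_
  have hterm : ∀ c ∈ (Finset.univ : Finset (κ × ι → ι)), v ((∏ j, a j (c j)) *
        (Matrix.of fun j x : κ × ι => if c j = x.2 then b j x.1 else 0).det) ≤
      C ^ Fintype.card (κ × ι) * Q ^ Fintype.card ι := by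
    intro c _
    rw [map_mul, map_prod]
    refine mul_le_mul ?_ (abs_det_coloured_le v b hQ0 hQ c) (v.nonneg _) (by positivity)
    refine (Finset.prod_le_prod (fun _ _ => v.nonneg _) (fun j _ => hC j (c j))).trans_eq ?_
    simp
  refine (Finset.sum_le_card_nsmul _ _ _ hterm).trans_eq ?_
  rw [nsmul_eq_mul, Finset.card_univ, Fintype.card_fun, mul_pow]
  push_cast
  ring

/-- The determinant of the matrix of monomials of degree `n - 1` at `n` points of the plane. -/
def vandermondeDet {n : ℕ} (z : Fin n → Fin 2 → K) : K :=
  (Matrix.projVandermonde (fun j => z j 0) (fun j => z j 1)).det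

theorem prod_wedge_eq_sq (v : AbsoluteValue K ℝ) {n : ℕ} (z : Fin n → Fin 2 → K) :
    ∏ i, ∏ j ∈ Finset.univ.erase i, v (wedge (z i) (z j)) = v (vandermondeDet z) ^ 2 := by
  have hcomm : ∀ i j, v (wedge (z i) (z j)) = v (wedge (z j) (z i)) := by
    intro i j
    rw [← v.map_neg]; congr 1; simp only [wedge]; ring
  have := Finset.prod_prod_Ioi_mul_eq_prod_prod_off_diag (fun i j => v (wedge (z i) (z j)))
  simp only [Finset.compl_singleton] at this
  rw [Finset.prod_congr rfl fun i _ => Finset.prod_congr rfl fun j _ => hcomm i j]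
  rw [← this, vandermondeDet, Matrix.det_projVandermonde, map_prod, ← Finset.prod_pow]
  refine Finset.prod_congr rfl fun i _ => ?_
  rw [map_prod, ← Finset.prod_pow]
  refine Finset.prod_congr rfl fun j _ => ?_
  rw [hcomm i j, ← sq, wedge, mul_comm (z j 1)]

theorem natDegree_dehomogenize_le {G : MvPolynomial (Fin 2) K} {d : ℕ} (hG : G.IsHomogeneous d) :
    (dehomogenize G).natDegree ≤ d := by
  rw [dehomogenize, G.as_sum, map_sum]
  refine Polynomial.natDegree_sum_le_of_forall_le _ _ fun s hs => ?_
  have hs' : s 0 + s 1 = d := by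
    have := hG (MvPolynomial.mem_support_iff.1 hs)
    simpa [Finsupp.weight_apply, Finsupp.sum_fintype, Fin.sum_univ_two] using this
  rw [MvPolynomial.aeval_monomial, Finsupp.prod_fintype _ _ (by simp)]
  simp only [Fin.prod_univ_two, Matrix.cons_val_zero, Matrix.cons_val_one, one_pow, mul_one]
  refine (Polynomial.natDegree_C_mul_X_pow_le _ _).trans ?_
  omega

theorem homogenize_dehomogenize {G : MvPolynomial (Fin 2) K} {d : ℕ} (hG : G.IsHomogeneous d) :
    (dehomogenize G).homogenize d = G :=
  Polynomial.homogenize_eq_of_isHomogeneous hG rfl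

/-- The resultant transforms the Vandermonde determinant of `d * (m + 1)` points into that of
`m + 1` image points. -/
theorem abs_resultant_mul_vandermondeDet_le (v : AbsoluteValue K ℝ) {d : ℕ} (hd : 0 < d)
    {F : Fin 2 → MvPolynomial (Fin 2) K} (hF : ∀ i, (F i).IsHomogeneous d) (m : ℕ)
    {B Q : ℝ} (hB : 1 ≤ B) (z : Fin (d * m + d) → Fin 2 → K) (hz : ∀ j, maxNorm v (z j) ≤ B)
    (hQ0 : 0 ≤ Q)
    (hQ : ∀ y : Fin (m + 1) → Fin (d * m + d), v (vandermondeDet fun l => planeMap F (z (y l))) ≤ Q) :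
    v (homResultant d F) ^ (∑ k ∈ Finset.range (m + 1), k) * v (vandermondeDet z) ≤
      (d * B ^ (d - 1)) ^ (d * m + d) * Q ^ d := by
  have hdeg : ∀ i, (dehomogenize (F i)).natDegree ≤ d := fun i => natDegree_dehomogenize_le (hF i)
  have hhom : ∀ i, (dehomogenize (F i)).homogenize d = F i := fun i =>
    homogenize_dehomogenize (hF i)
  rw [homResultant, ← map_pow, ← det_powerFamilyMatrix hd (hdeg 0) (hdeg 1), ← map_mul, mul_comm,
    vandermondeDet, ← Matrix.det_mul]
  have hcard : (m + 1) * d = d * m + d := by ring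
  let e : Fin (m + 1) × Fin d ≃ Fin (d * m + d) := finProdFinEquiv.trans (finCongr hcard)
  have he : ∀ x, (e x : ℕ) = x.2 + d * x.1 := fun x => rfl
  have hmod : ∀ x, (e x : ℕ) % d = x.2 := fun x => by
    rw [he, Nat.add_mul_mod_self_left, Nat.mod_eq_of_lt x.2.2]
  have hdiv : ∀ x, (e x : ℕ) / d = x.1 := fun x => by
    rw [he, Nat.add_mul_div_left _ _ hd, Nat.div_eq_of_lt x.2.2, zero_add]
  -- The factors are monomials of degree `d - 1` in the point and of degree `m` in its image, so the
  -- minors of the second are Vandermonde determinants of `m + 1` image points.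
  have hM := abs_det_mul_le v (ι := Fin d) (κ := Fin (m + 1)) (C := B ^ (d - 1)) (Q := Q)
    (fun x i => z (e x) 0 ^ (i : ℕ) * z (e x) 1 ^ (d - 1 - i : ℕ))
    (fun x k => planeMap F (z (e x)) 0 ^ (k : ℕ) * planeMap F (z (e x)) 1 ^ (m - k : ℕ))
    (by positivity) ?_ hQ0 ?_
  · rw [← Matrix.det_submatrix_equiv_self e]
    convert hM using 2
    · congr 1
      ext x y
      rw [Matrix.submatrix_apply, projVandermonde_mul_powerFamilyMatrix hd (hdeg 0) (hdeg 1),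
        hhom, hhom, hmod, hdiv]
      rfl
    · simp [hcard]
    · simp
  · intro x i
    have h0 : v (z (e x) 0) ≤ B := (le_max_left _ _).trans (hz (e x))
    have h1 : v (z (e x) 1) ≤ B := (le_max_right _ _).trans (hz (e x))
    rw [map_mul, map_pow, map_pow]
    calc _ ≤ B ^ (i : ℕ) * B ^ (d - 1 - i : ℕ) := by gcongr
      _ = B ^ (d - 1) := by rw [← pow_add]; congr 1; omega
  · intro y
    convert hQ fun l => e (y l) using 3
    rw [vandermondeDet]
    congr 1
    ext l k
    simp [Matrix.projVandermonde_apply, Fin.val_rev]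

end DeterminantBound

/-! ### Nonvanishing of the resultant and boundedness of the filled Julia set. -/

section Resultant

open Polynomial

variable {K : Type*} [Field K]

theorem dehomogenize_map {L : Type*} [Field L] (φ : K →+* L) (G : MvPolynomial (Fin 2) K) :
    dehomogenize (MvPolynomial.map φ G) = (dehomogenize G).map φ := by
  rw [dehomogenize, dehomogenize, MvPolynomial.aeval_def, MvPolynomial.eval₂_map,
    MvPolynomial.aeval_def, ← Polynomial.coe_mapRingHom, MvPolynomial.hom_eval₂]
  congr 1
  · ext; simp
  · ext i; fin_cases i <;> simp

/-- Since `f` has full degree, a degree drop of `g` only contributes a power of the nonzero leading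
coefficient of `f`. -/
theorem resultant_ne_zero_of_isCoprime {f g : K[X]} {d : ℕ} (hf : f.natDegree = d)
    (hg : g.natDegree ≤ d) (h : IsCoprime f g) : resultant f g d d ≠ 0 := by
  rcases eq_or_ne f 0 with rfl | hf0
  · have : g.natDegree = 0 := natDegree_eq_zero_of_isUnit (isCoprime_zero_left.1 h)
    obtain rfl : d = 0 := by simpa using hf.symm
    simp
  obtain ⟨c, hc⟩ := le_iff_exists_add.mp hg
  have h1 := resultant_add_right_deg f g d g.natDegree c le_rfl
  rw [← hc] at h1
  rw [h1]
  refine mul_ne_zero (pow_ne_zero _ ?_) ?_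
  · rw [← hf, coeff_natDegree]; exact leadingCoeff_ne_zero.2 hf0
  · rw [← hf]; exact resultant_ne_zero f g h

theorem X_one_dvd_of_natDegree_lt {G : MvPolynomial (Fin 2) K} {d : ℕ} (hG : G.IsHomogeneous d)
    (h : (dehomogenize G).natDegree < d) : MvPolynomial.X 1 ∣ G := by
  have := homogenize_mul (dehomogenize G) 1 (m := d - 1) (n := 1) (by omega) (by simp)
  rw [mul_one, Nat.sub_add_cancel (by omega), homogenize_dehomogenize hG, homogenize_one,
    pow_one] at this
  exact ⟨_, this.trans (mul_comm _ _)⟩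

theorem homogenize_X_sub_C_dvd {G : MvPolynomial (Fin 2) K} {d : ℕ} (hG : G.IsHomogeneous d)
    (hd : 0 < d) {r : K} (h : (dehomogenize G).IsRoot r) : (X - C r).homogenize 1 ∣ G := by
  obtain ⟨q, hq⟩ := dvd_iff_isRoot.2 h
  have hqd : q.natDegree ≤ d - 1 := by
    have h1 := natDegree_dehomogenize_le hG
    rcases eq_or_ne q 0 with rfl | hq0
    · simp
    rw [hq, natDegree_mul (X_sub_C_ne_zero r) hq0, natDegree_X_sub_C] at h1
    omega
  have := homogenize_mul (X - C r) q (natDegree_X_sub_C_le r) hqd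
  rw [← hq, Nat.add_sub_cancel' hd, homogenize_dehomogenize hG] at this
  exact ⟨_, this⟩

theorem homResultant_ne_zero {F : Fin 2 → MvPolynomial (Fin 2) K} {d : ℕ} (hd : 0 < d)
    (hF : ∀ i, (F i).IsHomogeneous d) (hcop : NoCommonLinearFactor F) : homResultant d F ≠ 0 := by
  set φ := algebraMap K (AlgebraicClosure K)
  set G : Fin 2 → MvPolynomial (Fin 2) (AlgebraicClosure K) := fun i => MvPolynomial.map φ (F i)
  have hG : ∀ i, (G i).IsHomogeneous d := fun i => (hF i).map φ
  have hdeg : ∀ i, (dehomogenize (G i)).natDegree ≤ d := fun i => natDegree_dehomogenize_le (hG i)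
  suffices h : resultant (dehomogenize (G 0)) (dehomogenize (G 1)) d d ≠ 0 by
    intro h0
    apply h
    change resultant (dehomogenize (MvPolynomial.map φ (F 0)))
      (dehomogenize (MvPolynomial.map φ (F 1))) d d = 0
    rw [dehomogenize_map, dehomogenize_map, resultant_map_map]
    exact (congrArg φ h0).trans (map_zero φ)
  have hco : IsCoprime (dehomogenize (G 0)) (dehomogenize (G 1)) := by
    rw [isCoprime_iff_aeval_ne_zero_of_isAlgClosed (AlgebraicClosure K) (AlgebraicClosure K)]
    intro r
    by_contra! hr
    simp only [coe_aeval_eq_eval] at hr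
    refine hcop ((X - C r).homogenize 1) (isHomogeneous_homogenize _) ?_ ?_
    · rw [Ne, homogenize_eq_zero_iff (natDegree_X_sub_C_le r)]
      exact X_sub_C_ne_zero r
    · rw [Fin.forall_fin_two]
      exact ⟨homogenize_X_sub_C_dvd (hG 0) hd hr.1, homogenize_X_sub_C_dvd (hG 1) hd hr.2⟩
  -- Coprimality excludes common zeros in the affine chart only. If both degrees drop, the forms
  -- share the zero at infinity, that is, the factor `X 1`.
  by_cases h0 : (dehomogenize (G 0)).natDegree = d
  · exact resultant_ne_zero_of_isCoprime h0 (hdeg 1) hco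
  by_cases h1 : (dehomogenize (G 1)).natDegree = d
  · rw [resultant_comm]
    exact mul_ne_zero (by simp) (resultant_ne_zero_of_isCoprime h1 (hdeg 0) hco.symm)
  exfalso
  refine hcop (MvPolynomial.X 1) (MvPolynomial.isHomogeneous_X _ _) (MvPolynomial.X_ne_zero _) ?_
  rw [Fin.forall_fin_two]
  exact ⟨X_one_dvd_of_natDegree_lt (hG 0) (lt_of_le_of_ne (hdeg 0) h0),
    X_one_dvd_of_natDegree_lt (hG 1) (lt_of_le_of_ne (hdeg 1) h1)⟩

/-- Cramer's rule: the Sylvester map composed with its adjugate is multiplication by the resultant.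
-/
theorem exists_mul_add_mul_eq_C_resultant_mul {f g : K[X]} {m n : ℕ} (hf : f.natDegree ≤ m)
    (hg : g.natDegree ≤ n) {P : K[X]} (hP : P.degree < (m + n : ℕ)) :
    ∃ p q : K[X], p.degree < n ∧ q.degree < m ∧ f * p + g * q = C (resultant f g m n) * P := by
  have hP' : P ∈ degreeLT K (m + n) := mem_degreeLT.2 hP
  have := congr(($(sylveserMap_comp_adjSylvester f g hf hg) ⟨P, hP'⟩).1)
  refine ⟨(adjSylvester (m := m) (n := n) f g ⟨P, hP'⟩).2.1,
    (adjSylvester (m := m) (n := n) f g ⟨P, hP'⟩).1.1, mem_degreeLT.1 (Subtype.mem _),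
    mem_degreeLT.1 (Subtype.mem _), ?_⟩
  simpa [Algebra.smul_def] using this

theorem exists_abs_eval_homogenize_le (v : AbsoluteValue K ℝ) (p : K[X]) (n : ℕ) :
    ∃ C : ℝ, 0 ≤ C ∧ ∀ z : Fin 2 → K,
      v (MvPolynomial.eval z (p.homogenize n)) ≤ C * maxNorm v z ^ n := by
  refine ⟨∑ r : Fin (n + 1), v (p.coeff r), Finset.sum_nonneg fun _ _ => v.nonneg _, fun z => ?_⟩
  have h0 : v (z 0) ≤ maxNorm v z := le_max_left _ _
  have h1 : v (z 1) ≤ maxNorm v z := le_max_right _ _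
  rw [eval_homogenize_eq_sum, Finset.sum_mul]
  refine (v.sum_le _ _).trans (Finset.sum_le_sum fun r _ => ?_)
  rw [map_mul, map_mul, map_pow, map_pow]
  refine mul_le_mul_of_nonneg_left ?_ (v.nonneg _)
  calc _ ≤ maxNorm v z ^ (r : ℕ) * maxNorm v z ^ (r.rev : ℕ) :=
        mul_le_mul (pow_le_pow_left₀ (v.nonneg _) h0 _) (pow_le_pow_left₀ (v.nonneg _) h1 _)
          (pow_nonneg (v.nonneg _) _) (pow_nonneg ((v.nonneg _).trans h0) _)
    _ = maxNorm v z ^ n := by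
      rw [← pow_add]; congr 1; have := r.2; simp only [Fin.val_rev]; omega

theorem maxNorm_nonneg (v : AbsoluteValue K ℝ) (z : Fin 2 → K) : 0 ≤ maxNorm v z :=
  (v.nonneg _).trans (le_max_left _ _)

/-- Away from the common zeros, a pair of forms of degree `d` grows like the `d`-th power. -/
theorem exists_maxNorm_pow_le (v : AbsoluteValue K ℝ) {F : Fin 2 → MvPolynomial (Fin 2) K} {d : ℕ}
    (hd : 0 < d) (hF : ∀ i, (F i).IsHomogeneous d) (hR : homResultant d F ≠ 0) :
    ∃ C : ℝ, 0 < C ∧ ∀ z, maxNorm v z ^ d ≤ C * maxNorm v (planeMap F z) := by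
  have hR' : 0 < v (homResultant d F) := v.pos hR
  have key : ∀ k ≤ 2 * d - 1, ∃ C : ℝ, 0 ≤ C ∧ ∀ z : Fin 2 → K,
      v (z 0) ^ k * v (z 1) ^ (2 * d - 1 - k) ≤
        C * (maxNorm v (planeMap F z) * maxNorm v z ^ (d - 1)) := by
    intro k hk
    have hdeg := fun i => natDegree_dehomogenize_le (hF i)
    have hP : (X ^ k : K[X]).degree < (d + d : ℕ) := by
      rw [degree_X_pow]; exact_mod_cast (by omega)
    obtain ⟨p, q, hp, hq, hpq⟩ := exists_mul_add_mul_eq_C_resultant_mul (hdeg 0) (hdeg 1) hP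
    have hnat : ∀ {p : K[X]}, p.degree < d → p.natDegree ≤ d - 1 := by
      intro p hp
      rcases eq_or_ne p 0 with rfl | h0
      · simp
      have := (natDegree_lt_iff_degree_lt h0).2 hp
      omega
    obtain ⟨A, hA0, hA⟩ := exists_abs_eval_homogenize_le v p (d - 1)
    obtain ⟨B, hB0, hB⟩ := exists_abs_eval_homogenize_le v q (d - 1)
    refine ⟨(A + B) / v (homResultant d F), by positivity, fun z => ?_⟩
    -- Homogenizing the Bézout identity in degree `2d - 1` writes `R x^k y^(2d-1-k)` as a
    -- combination of `F₁, F₂` with coefficients of degree `d - 1`.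
    have h := congrArg (fun P : K[X] => MvPolynomial.eval z (P.homogenize (d + (d - 1)))) hpq
    simp only [homogenize_add, homogenize_C_mul] at h
    rw [homogenize_mul _ _ (hdeg 0) (hnat hp), homogenize_mul _ _ (hdeg 1) (hnat hq),
      homogenize_X_pow (by omega), homogenize_dehomogenize (hF 0),
      homogenize_dehomogenize (hF 1)] at h
    simp only [map_add, map_mul, map_pow, MvPolynomial.eval_X, MvPolynomial.eval_C] at h
    rw [← homResultant, show d + (d - 1) - k = 2 * d - 1 - k by omega] at h
    have h' := congrArg v h
    rw [map_mul, map_mul, map_pow, map_pow] at h'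
    rw [div_mul_eq_mul_div, le_div_iff₀ hR', mul_comm, ← h']
    refine (v.add_le _ _).trans ?_
    rw [map_mul, map_mul]
    have h0 : v (MvPolynomial.eval z (F 0)) ≤ maxNorm v (planeMap F z) := le_max_left _ _
    have h1 : v (MvPolynomial.eval z (F 1)) ≤ maxNorm v (planeMap F z) := le_max_right _ _
    have hn := maxNorm_nonneg v (planeMap F z)
    calc _ ≤ maxNorm v (planeMap F z) * (A * maxNorm v z ^ (d - 1)) +
          maxNorm v (planeMap F z) * (B * maxNorm v z ^ (d - 1)) :=
          add_le_add (mul_le_mul h0 (hA z) (v.nonneg _) hn) (mul_le_mul h1 (hB z) (v.nonneg _) hn)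
      _ = _ := by ring
  obtain ⟨A, hA0, hA⟩ := key 0 (by omega)
  obtain ⟨B, hB0, hB⟩ := key (2 * d - 1) le_rfl
  refine ⟨A + B + 1, by positivity, fun z => ?_⟩
  rcases (maxNorm_nonneg v z).eq_or_lt with h0 | hpos
  · rw [← h0, zero_pow hd.ne']
    exact mul_nonneg (by positivity) (maxNorm_nonneg _ _)
  have hn := maxNorm_nonneg v (planeMap F z)
  have hmain : maxNorm v z ^ (2 * d - 1) ≤
      (A + B + 1) * (maxNorm v (planeMap F z) * maxNorm v z ^ (d - 1)) := by
    rcases max_choice (v (z 0)) (v (z 1)) with h | h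
    · have h2 := hB z
      rw [Nat.sub_self, pow_zero, mul_one, ← h] at h2
      refine h2.trans (mul_le_mul_of_nonneg_right (by linarith) (by positivity))
    · have h2 := hA z
      rw [Nat.sub_zero, pow_zero, one_mul, ← h] at h2
      refine h2.trans (mul_le_mul_of_nonneg_right (by linarith) (by positivity))
  rw [show 2 * d - 1 = d + (d - 1) by omega, pow_add, ← mul_assoc] at hmain
  exact le_of_mul_le_mul_right hmain (by positivity)

theorem isBoundedFor_filledJulia (v : AbsoluteValue K ℝ) {F : Fin 2 → MvPolynomial (Fin 2) K}
    {d : ℕ} (hd : 2 ≤ d) (hF : ∀ i, (F i).IsHomogeneous d) (hR : homResultant d F ≠ 0) :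
    IsBoundedFor v (filledJulia v F) := by
  obtain ⟨C, hC, h⟩ := exists_maxNorm_pow_le v (by omega) hF hR
  -- Beyond this radius `C * ‖F w‖ ≥ ‖w‖ ^ d ≥ ‖w‖ ^ 2 ≥ 2 * C * ‖w‖`, so the norm at least doubles
  -- at every iteration.
  refine ⟨max 1 (2 * C), fun z hz => ?_⟩
  by_contra! hlt
  obtain ⟨B, hB⟩ := hz
  have hstep : ∀ w, max 1 (2 * C) < maxNorm v w → 2 * maxNorm v w ≤ maxNorm v (planeMap F w) := by
    intro w hw
    have h1 : 1 ≤ maxNorm v w := (le_max_left _ _).trans hw.le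
    have h2 : 2 * C ≤ maxNorm v w := (le_max_right _ _).trans hw.le
    have h3 : maxNorm v w ^ 2 ≤ maxNorm v w ^ d := pow_le_pow_right₀ h1 hd
    have h4 : C * (2 * maxNorm v w) ≤ C * maxNorm v (planeMap F w) := by
      refine le_trans ?_ (h3.trans (h w))
      nlinarith
    exact le_of_mul_le_mul_left h4 hC
  have hiter : ∀ n : ℕ, 2 ^ n * maxNorm v z ≤ maxNorm v ((planeMap F)^[n] z) := by
    intro n
    induction n with
    | zero => simp
    | succ n ih =>
      rw [Function.iterate_succ_apply']
      have h1 : (1 : ℝ) ≤ 2 ^ n := one_le_pow₀ one_le_two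
      have h2 : maxNorm v z ≤ 2 ^ n * maxNorm v z :=
        le_mul_of_one_le_left (maxNorm_nonneg v z) h1
      have := hstep _ (hlt.trans_le (h2.trans ih))
      rw [pow_succ]; linarith
  obtain ⟨n, hn⟩ := pow_unbounded_of_one_lt B one_lt_two
  have h1 : 1 ≤ maxNorm v z := (le_max_left _ _).trans hlt.le
  have h2 := (hiter n).trans (hB n)
  have h3 : (2 : ℝ) ^ n ≤ 2 ^ n * maxNorm v z := le_mul_of_one_le_right (by positivity) h1
  linarith

theorem zero_mem_filledJulia (v : AbsoluteValue K ℝ) {F : Fin 2 → MvPolynomial (Fin 2) K}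
    {d : ℕ} (hd : 0 < d) (hF : ∀ i, (F i).IsHomogeneous d) : 0 ∈ filledJulia v F := by
  have h0 : planeMap F 0 = 0 := by
    ext i
    rw [planeMap, MvPolynomial.eval_zero, MvPolynomial.constantCoeff_eq,
      (hF i).coeff_eq_zero (by simpa using hd.ne), Pi.zero_apply]
  exact ⟨0, fun n => by rw [Function.iterate_fixed h0]; simp [maxNorm]⟩

theorem planeMap_mem_filledJulia {v : AbsoluteValue K ℝ} {F : Fin 2 → MvPolynomial (Fin 2) K}
    {z : Fin 2 → K} (hz : z ∈ filledJulia v F) : planeMap F z ∈ filledJulia v F := by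
  obtain ⟨B, hB⟩ := hz
  exact ⟨B, fun n => by simpa only [← Function.iterate_succ_apply] using hB (n + 1)⟩

end Resultant

/-! ### Fekete monotonicity and existence of the transfinite diameter. -/

section Diameter

variable {K : Type*} [Field K] {v : AbsoluteValue K ℝ} {E : Set (Fin 2 → K)}

theorem homDiameter_eq_iSup (v : AbsoluteValue K ℝ) (E : Set (Fin 2 → K)) (n : ℕ) :
    homDiameter v E n = ⨆ z : Fin n → E,
      (v (vandermondeDet fun i => (z i : Fin 2 → K)) ^ 2) ^ (1 / ((n : ℝ) * ((n : ℝ) - 1))) := by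
  simp only [homDiameter, ← prod_wedge_eq_sq]

theorem homDiameter_nonneg (v : AbsoluteValue K ℝ) (E : Set (Fin 2 → K)) (n : ℕ) :
    0 ≤ homDiameter v E n := by
  rw [homDiameter_eq_iSup]
  exact Real.iSup_nonneg fun _ => by positivity

theorem cast_mul_pred {n : ℕ} (hn : 2 ≤ n) : ((n * (n - 1) : ℕ) : ℝ) = (n : ℝ) * ((n : ℝ) - 1) := by
  rw [Nat.cast_mul, Nat.cast_sub (by omega), Nat.cast_one]

theorem mul_pred_ne_zero {n : ℕ} (hn : 2 ≤ n) : n * (n - 1) ≠ 0 :=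
  mul_ne_zero (by omega) (by omega)

theorem sq_vandermondeDet_le (hE : IsBoundedFor v E) {n : ℕ} (hn : 2 ≤ n)
    {z : Fin n → Fin 2 → K} (hz : ∀ i, z i ∈ E) :
    v (vandermondeDet z) ^ 2 ≤ homDiameter v E n ^ (n * (n - 1)) := by
  obtain ⟨B, hB⟩ := hE
  have hwedge : ∀ x ∈ E, ∀ y ∈ E, v (wedge x y) ≤ B * B + B * B := by
    intro x hx y hy
    have hx0 : v (x 0) ≤ B := (le_max_left _ _).trans (hB x hx)
    have hx1 : v (x 1) ≤ B := (le_max_right _ _).trans (hB x hx)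
    have hy0 : v (y 0) ≤ B := (le_max_left _ _).trans (hB y hy)
    have hy1 : v (y 1) ≤ B := (le_max_right _ _).trans (hB y hy)
    have hB0 : 0 ≤ B := (v.nonneg _).trans hx0
    refine (v.sub_le_add _ _).trans ?_
    rw [map_mul, map_mul]
    exact add_le_add (mul_le_mul hx0 hy1 (v.nonneg _) hB0) (mul_le_mul hx1 hy0 (v.nonneg _) hB0)
  -- A real supremum bounds its terms only when the family is bounded above; for an unbounded family
  -- it takes the default value `0`.
  have hbdd : BddAbove (Set.range fun z : Fin n → E =>
      (v (vandermondeDet fun i => (z i : Fin 2 → K)) ^ 2) ^ (1 / ((n : ℝ) * ((n : ℝ) - 1)))) := by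
    refine ⟨(∏ i : Fin n, ∏ _j ∈ Finset.univ.erase i, (B * B + B * B)) ^
      (1 / ((n : ℝ) * ((n : ℝ) - 1))), ?_⟩
    rintro _ ⟨w, rfl⟩
    refine Real.rpow_le_rpow (by positivity) ?_ ?_
    · rw [← prod_wedge_eq_sq]
      exact Finset.prod_le_prod (fun i _ => Finset.prod_nonneg fun j _ => v.nonneg _) fun i _ =>
        Finset.prod_le_prod (fun j _ => v.nonneg _) fun j _ => hwedge _ (w i).2 _ (w j).2
    · rw [← cast_mul_pred hn]; positivity
  have h := le_ciSup hbdd fun i => ⟨z i, hz i⟩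
  rw [← homDiameter_eq_iSup] at h
  dsimp only at h
  rw [one_div, ← cast_mul_pred hn] at h
  calc _ = ((v (vandermondeDet z) ^ 2) ^ ((n * (n - 1) : ℕ) : ℝ)⁻¹) ^ (n * (n - 1)) :=
        (Real.rpow_inv_natCast_pow (by positivity) (mul_pred_ne_zero hn)).symm
    _ ≤ _ := pow_le_pow_left₀ (by positivity) h _

theorem homDiameter_pow_le (hE : E.Nonempty) {n : ℕ} (hn : 2 ≤ n) {M : ℝ} (hM : 0 ≤ M)
    (h : ∀ z : Fin n → Fin 2 → K, (∀ i, z i ∈ E) → v (vandermondeDet z) ^ 2 ≤ M) :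
    homDiameter v E n ^ (n * (n - 1)) ≤ M := by
  have : Nonempty E := hE.to_subtype
  have h1 : homDiameter v E n ≤ M ^ ((n * (n - 1) : ℕ) : ℝ)⁻¹ := by
    rw [homDiameter_eq_iSup]
    refine ciSup_le fun z => ?_
    rw [one_div, ← cast_mul_pred hn]
    exact Real.rpow_le_rpow (by positivity) (h _ fun i => (z i).2) (by positivity)
  calc _ ≤ (M ^ ((n * (n - 1) : ℕ) : ℝ)⁻¹) ^ (n * (n - 1)) :=
        pow_le_pow_left₀ (homDiameter_nonneg v E n) h1 _
    _ = M := Real.rpow_inv_natCast_pow hM (mul_pred_ne_zero hn)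

/-- Isolates one point in Fekete's argument: by symmetry, the pairs involving `k` occur once in each
order, hence the square. -/
theorem prod_prod_erase_succAbove {n : ℕ} (g : Fin (n + 1) → Fin (n + 1) → ℝ)
    (hg : ∀ i j, g i j = g j i) (k : Fin (n + 1)) :
    ∏ i, ∏ j ∈ Finset.univ.erase i, g i j =
      (∏ i : Fin n, ∏ j ∈ Finset.univ.erase i, g (k.succAbove i) (k.succAbove j)) *
        (∏ j ∈ Finset.univ.erase k, g k j) ^ 2 := by
  have key : ∀ {m : ℕ} (f : Fin m → Fin m → ℝ) (i : Fin m),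
      ∏ j ∈ Finset.univ.erase i, f i j = ∏ j, if i = j then 1 else f i j := by
    intro m f i
    rw [← Finset.mul_prod_erase Finset.univ _ (Finset.mem_univ i), if_pos rfl, one_mul]
    exact Finset.prod_congr rfl fun j hj => by rw [if_neg (Finset.ne_of_mem_erase hj).symm]
  rw [Finset.prod_congr rfl fun i _ => key g i, key g k,
    Finset.prod_congr rfl fun i _ => key (fun i j => g (k.succAbove i) (k.succAbove j)) i,
    Fin.prod_univ_succAbove _ k,
    Finset.prod_congr (s₁ := Finset.univ (α := Fin n)) rfl
      fun i _ => Fin.prod_univ_succAbove _ k, Finset.prod_mul_distrib]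
  have : ∏ i : Fin n, (if k.succAbove i = k then 1 else g (k.succAbove i) k) =
      ∏ j, if k = j then 1 else g k j := by
    rw [Fin.prod_univ_succAbove _ k, if_pos rfl, one_mul]
    refine Finset.prod_congr rfl fun i _ => ?_
    rw [hg, if_neg (Fin.succAbove_ne k i), if_neg (Fin.succAbove_ne k i).symm]
  rw [this]
  simp only [Fin.succAbove_right_inj]
  ring

/-- Fekete's inequality. -/
theorem homDiameter_succ_le (hE : IsBoundedFor v E) (hE' : E.Nonempty) {n : ℕ} (hn : 2 ≤ n) :
    homDiameter v E (n + 1) ≤ homDiameter v E n := by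
  have hD := homDiameter_nonneg v E n
  refine le_of_pow_le_pow_left₀ (mul_pred_ne_zero (n := n + 1) (by omega)) hD ?_
  refine homDiameter_pow_le hE' (by omega) (by positivity) fun z hz => ?_
  set P := v (vandermondeDet z) ^ 2 with hP
  have hP0 : 0 ≤ P := by positivity
  rcases hP0.eq_or_lt with h0 | hpos
  · rw [← h0]; positivity
  set R : Fin (n + 1) → ℝ := fun k => ∏ j ∈ Finset.univ.erase k, v (wedge (z k) (z j)) with hR
  have hPR : P = ∏ k, R k := (prod_wedge_eq_sq v z).symm
  have hcomm : ∀ i j, v (wedge (z i) (z j)) = v (wedge (z j) (z i)) := by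
    intro i j
    rw [← v.map_neg]; congr 1; simp only [wedge]; ring
  have hk : ∀ k : Fin (n + 1), P ≤ homDiameter v E n ^ (n * (n - 1)) * R k ^ 2 := by
    intro k
    rw [hP, ← prod_wedge_eq_sq, prod_prod_erase_succAbove _ hcomm k]
    refine mul_le_mul_of_nonneg_right ?_ (by positivity)
    rw [prod_wedge_eq_sq v fun i => z (k.succAbove i)]
    exact sq_vandermondeDet_le hE hn fun i => hz _
  -- Multiplying the bounds obtained by deleting each point in turn uses `∏ R k = P`. Cancelling `P
  -- ^ 2` and taking an `(n - 1)`-th root finishes.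
  have h1 : P ^ (n + 1) ≤ (homDiameter v E n ^ (n * (n - 1))) ^ (n + 1) * P ^ 2 := by
    have := Finset.prod_le_prod (s := Finset.univ) (fun _ _ => hP0) fun k _ => hk k
    rwa [Finset.prod_const, Finset.prod_mul_distrib, Finset.prod_const, Finset.prod_pow, ← hPR,
      Finset.card_univ, Fintype.card_fin] at this
  obtain ⟨m, rfl⟩ : ∃ m, n = m + 1 := ⟨n - 1, by omega⟩
  rw [show m + 1 + 1 = m + 2 by ring, pow_add P] at h1
  have h2 := le_of_mul_le_mul_right h1 (by positivity)
  refine le_of_pow_le_pow_left₀ (n := m) (by omega) (by positivity) (h2.trans_eq ?_)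
  rw [← pow_mul, ← pow_mul]
  congr 1
  simp only [Nat.add_sub_cancel]
  ring

/-- The shift by `2` skips `n = 0, 1`, where the exponent is `1 / 0 = 0` and the diameter takes the
meaningless value `1`. -/
theorem antitone_homDiameter (hE : IsBoundedFor v E) (hE' : E.Nonempty) :
    Antitone fun n => homDiameter v E (n + 2) :=
  antitone_nat_of_succ_le fun n => homDiameter_succ_le hE hE' (by omega)

theorem tendsto_homDiameter (hE : IsBoundedFor v E) (hE' : E.Nonempty) :
    Tendsto (homDiameter v E) atTop (𝓝 (homTransfiniteDiameter v E)) := by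
  have h := tendsto_atTop_ciInf (antitone_homDiameter hE hE')
    ⟨0, by rintro _ ⟨n, rfl⟩; exact homDiameter_nonneg v E _⟩
  exact tendsto_nhds_limUnder ⟨_, (tendsto_add_atTop_iff_nat 2).1 h⟩

theorem homTransfiniteDiameter_le_homDiameter (hE : IsBoundedFor v E) (hE' : E.Nonempty) {n : ℕ}
    (hn : 2 ≤ n) : homTransfiniteDiameter v E ≤ homDiameter v E n := by
  have h := (antitone_homDiameter hE hE').le_of_tendsto
    ((tendsto_add_atTop_iff_nat 2).2 (tendsto_homDiameter hE hE')) (n - 2)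
  simpa only [Nat.sub_add_cancel hn] using h

end Diameter

/-- Passage to the limit in `m`-th roots without taking roots: if `L < ρ < a`, then `(a / ρ) ^ m`
eventually exceeds the fixed constant `A / c`. -/
theorem le_of_forall_pow_mul_le {a c A L : ℝ} {u : ℕ → ℝ} (hc : 0 < c) (hA : 0 ≤ A) (hL : 0 ≤ L)
    (hu0 : ∀ m, 0 ≤ u m) (hu : Tendsto u atTop (𝓝 L)) (h : ∀ᶠ m in atTop, a ^ m * c ≤ A * u m ^ m) :
    a ≤ L := by
  by_contra! hlt
  obtain ⟨ρ, hLρ, hρa⟩ := exists_between hlt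
  have hρ : 0 < ρ := hL.trans_lt hLρ
  have hr : 1 < a / ρ := (one_lt_div hρ).2 hρa
  have hlarge := (tendsto_pow_atTop_atTop_of_one_lt hr).eventually_gt_atTop (A / c)
  obtain ⟨m, hm, hm', hm''⟩ := (h.and (hlarge.and (hu.eventually_lt_const hLρ))).exists
  rw [div_pow, div_lt_div_iff₀ hc (by positivity)] at hm'
  have : A * u m ^ m ≤ A * ρ ^ m :=
    mul_le_mul_of_nonneg_left (pow_le_pow_left₀ (hu0 m) hm''.le m) hA
  linarith

/-! ### The functional inequality between diameters and its limit. -/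

section Main

variable {K : Type*} [Field K]

/-- After squaring the determinant bound for `N = d * (m + 1)` points, every exponent is divisible
by `m + 1`. The `(m + 1)`-th root turns the exponential factor `C ^ (2 * N)` into the constant `C ^
(2 * d)`. -/
theorem resultant_pow_mul_homDiameter_pow_le (v : AbsoluteValue K ℝ) {d : ℕ} (hd : 2 ≤ d)
    {F : Fin 2 → MvPolynomial (Fin 2) K} (hF : ∀ i, (F i).IsHomogeneous d)
    (hR : homResultant d F ≠ 0) :
    ∃ A : ℝ, 0 ≤ A ∧ ∀ m : ℕ, 1 ≤ m →
      v (homResultant d F) ^ m *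
          homDiameter v (filledJulia v F) (d * m + d) ^ (d * (d * m + d - 1)) ≤
        A * homDiameter v (filledJulia v F) (m + 1) ^ (d * m) := by
  have hbdd := isBoundedFor_filledJulia v hd hF hR
  have hne : (filledJulia v F).Nonempty := ⟨0, zero_mem_filledJulia v (by omega) hF⟩
  have hR' := v.pos hR
  obtain ⟨B, hB⟩ := hbdd
  set C : ℝ := d * max 1 B ^ (d - 1)
  have hC0 : 0 ≤ C := by positivity
  refine ⟨C ^ (2 * d), by positivity, fun m hm => ?_⟩
  set D := homDiameter v (filledJulia v F) (m + 1) with hD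
  have hD0 : 0 ≤ D := homDiameter_nonneg _ _ _
  set N := d * m + d with hN
  have hN2 : 2 ≤ N := by omega
  have hNm : N = d * (m + 1) := by rw [hN]; ring
  have hQ : ∀ y : Fin (m + 1) → Fin 2 → K, (∀ i, y i ∈ filledJulia v F) →
      v (vandermondeDet y) ≤ √(D ^ ((m + 1) * m)) := fun y hy =>
    Real.le_sqrt_of_sq_le (sq_vandermondeDet_le ⟨B, hB⟩ (by omega) hy)
  have hsum : (∑ k ∈ Finset.range (m + 1), k) * 2 = (m + 1) * m :=
    Finset.sum_range_id_mul_two (m + 1)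
  have hmain : ∀ z : Fin N → Fin 2 → K, (∀ i, z i ∈ filledJulia v F) →
      v (vandermondeDet z) ^ 2 ≤
        (C ^ N) ^ 2 * (D ^ ((m + 1) * m)) ^ d / v (homResultant d F) ^ ((m + 1) * m) := by
    intro z hz
    have h := abs_resultant_mul_vandermondeDet_le v (by omega) hF m (le_max_left 1 B) z
      (fun j => (hB _ (hz j)).trans (le_max_right _ _)) (Real.sqrt_nonneg _)
      (fun y => hQ _ fun i => planeMap_mem_filledJulia (hz (y i)))
    have h2 := pow_le_pow_left₀ (by positivity) h 2
    rw [mul_pow, ← pow_mul, hsum, mul_pow, ← pow_mul (√_), mul_comm d 2, pow_mul (√_),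
      Real.sq_sqrt (by positivity)] at h2
    rw [le_div_iff₀ (by positivity), mul_comm]
    exact h2
  have h := homDiameter_pow_le hne hN2 (by positivity) hmain
  clear_value C
  rw [le_div_iff₀ (by positivity)] at h
  refine le_of_pow_le_pow_left₀ (n := m + 1) (by omega) (by positivity) ?_
  calc _ = homDiameter v (filledJulia v F) N ^ (N * (N - 1)) *
        v (homResultant d F) ^ ((m + 1) * m) := by
        rw [mul_pow, ← pow_mul, ← pow_mul, mul_comm, mul_comm m (m + 1)]
        congr 2
        conv_rhs => rw [hNm]
        rw [hNm]; ring
    _ ≤ _ := h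
    _ = _ := by
      rw [mul_pow, ← pow_mul, ← pow_mul, ← pow_mul, ← pow_mul]
      congr 2
      · rw [hNm]; ring
      · ring

end Main

theorem mainTheorem7 {K : Type*} [Field K] (v : AbsoluteValue K ℝ) (d : ℕ) (hd : 2 ≤ d)
    (F : Fin 2 → MvPolynomial (Fin 2) K) (hF : ∀ i, (F i).IsHomogeneous d)
    (hcop : NoCommonLinearFactor F) :
    IsBoundedFor v (filledJulia v F) ∧
      Tendsto (homDiameter v (filledJulia v F)) atTop
        (𝓝 (homTransfiniteDiameter v (filledJulia v F))) ∧
      homResultant d F ≠ 0 ∧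
      homTransfiniteDiameter v (filledJulia v F) ≤
        v (homResultant d F) ^ (-(1 / ((d : ℝ) * ((d : ℝ) - 1)))) := by
  have hR := homResultant_ne_zero (by omega) hF hcop
  have hbdd := isBoundedFor_filledJulia v hd hF hR
  have hne : (filledJulia v F).Nonempty := ⟨0, zero_mem_filledJulia v (by omega) hF⟩
  have htend := tendsto_homDiameter hbdd hne
  refine ⟨hbdd, htend, hR, ?_⟩
  have hR' : 0 < v (homResultant d F) := v.pos hR
  set D := homTransfiniteDiameter v (filledJulia v F)
  have hD0 : 0 ≤ D := ge_of_tendsto' htend fun n => homDiameter_nonneg _ _ n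
  -- The case `D = 0` is trivial, and is set apart because a factor `D ^ d` is cancelled below.
  rcases hD0.eq_or_lt with h0 | hpos
  · rw [← h0]; positivity
  obtain ⟨A, hA0, hA⟩ := resultant_pow_mul_homDiameter_pow_le v hd hF hR
  have hle : v (homResultant d F) * D ^ (d * d) ≤ D ^ d := by
    -- The exponent `d * (d * m + d - 1)` splits as `d * d * m + d * (d - 1)`, and `c` absorbs the
    -- part independent of `m`. On the left the diameter of order `d * m + d` is bounded below by
    -- its limit `D`; on the right convergence is used.
    refine le_of_forall_pow_mul_le (c := D ^ (d * (d - 1))) (A := A)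
      (u := fun m => homDiameter v (filledJulia v F) (m + 1) ^ d) (by positivity) hA0 (by positivity)
      (fun m => pow_nonneg (homDiameter_nonneg _ _ _) _)
      (((tendsto_add_atTop_iff_nat 1).2 htend).pow d) ?_
    filter_upwards [eventually_ge_atTop 1] with m hm
    rw [← pow_mul]
    refine le_trans ?_ (hA m hm)
    rw [mul_pow, mul_assoc, ← pow_mul, ← pow_add]
    refine mul_le_mul_of_nonneg_left ?_ (by positivity)
    rw [show d * d * m + d * (d - 1) = d * (d * m + d - 1) by
      rw [Nat.add_sub_assoc (by omega), mul_add, mul_assoc]]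
    exact pow_le_pow_left₀ hD0 (homTransfiniteDiameter_le_homDiameter hbdd hne (by omega)) _
  have hpow : D ^ (d * (d - 1)) ≤ (v (homResultant d F))⁻¹ := by
    rw [← one_div, le_div_iff₀ hR', mul_comm]
    refine le_of_mul_le_mul_right ?_ (pow_pos hpos d)
    rwa [one_mul, mul_assoc, ← pow_add, ← Nat.mul_succ, Nat.succ_eq_add_one,
      Nat.sub_add_cancel (by omega)]
  rw [Real.rpow_neg hR'.le, ← Real.inv_rpow hR'.le, one_div, ← cast_mul_pred hd]
  calc D = (D ^ (d * (d - 1))) ^ ((d * (d - 1) : ℕ) : ℝ)⁻¹ :=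
        (Real.pow_rpow_inv_natCast hD0 (mul_pred_ne_zero hd)).symm
    _ ≤ _ := Real.rpow_le_rpow (by positivity) hpow (by positivity)
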